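/- Let $A=\mathbb{C}^n$ and $B=\mathbb{C}^n$ with their standard bases, let $\mathcal{L}(A)$ be the operators on $A$, $\mathrm{Herm}(A)$ the real vector space of Hermitian operators, and $|\Phi\rangle=\sum_i|i\rangle\otimes|i\rangle\in A\otimes B$. Let $S\subseteq\mathcal{L}(A)$ be a non-commutative graph, that is, a complex linear subspace with $S=S^\dagger$ and $I\in S$. For $W\ge 0$ put $|\sqrt W\rangle=(\sqrt W\otimes I)|\Phi\rangle$ and $$\tilde\vartheta(S,W)=\min\{\lambda\in\mathbb{R} : Y\in S\otimes\mathcal{L}(B),\ \mathrm{Tr}_A Y\le\lambda I,\ Y\ge|\sqrt W\rangle\langle\sqrt W|\},$$ and define the theta body $$\mathrm{TH}(S)=\{X\ge 0 : \mathrm{Tr}(XW)\le 1\ \text{for all } W\ge 0 \text{ with } \tilde\vartheta(S,W)\le 1\}.$$ A facet of a non-empty closed convex set $C\subseteq\mathrm{Herm}(A)$ is a non-empty subset $F$ of the boundary of $C$ (in $\mathrm{Herm}(A)$), of affine dimension $\dim\mathcal{L}(A)-1=n^2-1$ over $\mathbb{R}$, of the form $F=\{X\in C:\mathrm{Tr}(XY)=\alpha\}$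 with $0\ne Y\in\mathrm{Herm}(A)$, $\alpha\in\mathbb{R}$ and $\mathrm{Tr}(XY)\le\alpha$ for all $X\in C$. A projector $P=P^\dagger=P^2$ in $\mathcal{L}(A)$ is $S$-full if $P\,\mathcal{L}(A)\,P\subseteq S$, and it is a maximal $S$-full projector if no $S$-full projector $Q\ne P$ satisfies $Q\ge P$. **Theorem.** (1) If $V\in\mathcal{L}(A)$ is such that $\{X\in\mathrm{TH}(S):\mathrm{Tr}(XV)=1\}$ is a facet of $\mathrm{TH}(S)$, then $V$ is a maximal $S$-full projector. (2) If $n>1$, every facet of $\mathrm{TH}(S)$ is of this form: it equals $\{X\in\mathrm{TH}(S):\mathrm{Tr}(XV)=1\}$ for some maximal $S$-full projector $V$. -/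

import Mathlib

open scoped Kronecker ComplexOrder MatrixOrder

noncomputable section

namespace ThetaFacet

variable {ι : Type*} [Fintype ι] [DecidableEq ι]

/-- The real vector space of Hermitian operators on `ℂ^ι`. -/
abbrev Herm (ι : Type*) [Fintype ι] [DecidableEq ι] : Type _ :=
  selfAdjoint (Matrix ι ι ℂ)

/-- A non-commutative graph: an operator subspace `S = S†` with `I ∈ S`. -/
structure IsNoncommGraph (S : Submodule ℂ (Matrix ι ι ℂ)) : Prop where
  conjTranspose_mem : ∀ A ∈ S, A.conjTranspose ∈ S
  one_mem : (1 : Matrix ι ι ℂ) ∈ S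

/-- The operator space `S ⊗ L(B)` with `B = ℂ^ι`, inside the operators on `A ⊗ B = ℂ^(ι × ι)`. -/
def tensorFull (S : Submodule ℂ (Matrix ι ι ℂ)) : Submodule ℂ (Matrix (ι × ι) (ι × ι) ℂ) :=
  Submodule.span ℂ {K | ∃ A ∈ S, ∃ B : Matrix ι ι ℂ, K = A ⊗ₖ B}

/-- The partial trace over the first tensor factor `A`. -/
def partialTraceA (Y : Matrix (ι × ι) (ι × ι) ℂ) : Matrix ι ι ℂ :=
  Matrix.of fun j j' => ∑ i, Y (i, j) (i, j')

/-- The unnormalized maximally entangled vector `|Φ⟩ = ∑ i, |i⟩ ⊗ |i⟩`. -/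
def maxEnt : ι × ι → ℂ := fun p => if p.1 = p.2 then 1 else 0

/-- The vectorization `|M⟩ = (M ⊗ I)|Φ⟩` of an operator `M`. -/
def vectorize (M : Matrix ι ι ℂ) : ι × ι → ℂ :=
  (M ⊗ₖ (1 : Matrix ι ι ℂ)).mulVec maxEnt

/-- The rank-one operator `|v⟩⟨v|`. -/
def ketBra (v : ι × ι → ℂ) : Matrix (ι × ι) (ι × ι) ℂ :=
  Matrix.vecMulVec v (star v)

/-- The values `t` admitted by a feasible `Y` in the semidefinite program for the weighted theta
function: `Y ∈ S ⊗ L(B)`, `Tr_A Y ≤ t I` and `Y ≥ |√W⟩⟨√W|`. -/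
def thetaFeasible (S : Submodule ℂ (Matrix ι ι ℂ)) (W : Matrix ι ι ℂ) : Set ℝ :=
  {t | ∃ Y ∈ tensorFull S,
    ((t : ℂ) • (1 : Matrix ι ι ℂ) - partialTraceA Y).PosSemidef ∧
    (Y - ketBra (vectorize (CFC.sqrt W))).PosSemidef}

/-- The square root used above is the positive semidefinite one. -/
theorem sqrt_spec {W : Matrix ι ι ℂ} (hW : W.PosSemidef) :
    (CFC.sqrt W).PosSemidef ∧ CFC.sqrt W * CFC.sqrt W = W :=
  ⟨Matrix.nonneg_iff_posSemidef.mp (CFC.sqrt_nonneg W),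
    CFC.sqrt_mul_sqrt_self W (Matrix.nonneg_iff_posSemidef.mpr hW)⟩

theorem vectorize_apply (M : Matrix ι ι ℂ) (i j : ι) : vectorize M (i, j) = M i j := by
  simp [vectorize, maxEnt, Matrix.mulVec, dotProduct, Fintype.sum_prod_type, Matrix.one_apply]

/-- The weighted theta function of a non-commutative graph, for a weight `W ≥ 0`. -/
def theta (S : Submodule ℂ (Matrix ι ι ℂ)) (W : Matrix ι ι ℂ) : ℝ :=
  sInf (thetaFeasible S W)

/-- The theta body `{X ≥ 0 : Tr(XW) ≤ 1 for all W ≥ 0 with theta(S, W) ≤ 1}`, as a set in the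
space of Hermitian operators. -/
def thetaBody (S : Submodule ℂ (Matrix ι ι ℂ)) : Set (Herm ι) :=
  {X | (X : Matrix ι ι ℂ).PosSemidef ∧
    ∀ W : Matrix ι ι ℂ, W.PosSemidef → theta S W ≤ 1 →
      ((X : Matrix ι ι ℂ) * W).trace.re ≤ 1}

/-- `F` is a facet of the closed convex set `C` of Hermitian operators: a part of the boundary
of `C`, of affine dimension `dim L(A) - 1`, cut out by a single supporting hyperplane.
Boundary and dimension refer to the real space of Hermitian operators. -/
structure IsFacet (C F : Set (Herm ι)) : Prop where
  nonempty : F.Nonempty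
  subset_frontier : F ⊆ frontier C
  finrank_direction :
    Module.finrank ℝ (affineSpan ℝ F).direction + 1 = Module.finrank ℂ (Matrix ι ι ℂ)
  exists_hyperplane : ∃ (Y : Herm ι) (a : ℝ), Y ≠ 0 ∧
    (∀ X ∈ C, ((X : Matrix ι ι ℂ) * (Y : Matrix ι ι ℂ)).trace.re ≤ a) ∧
    F = {X | X ∈ C ∧ ((X : Matrix ι ι ℂ) * (Y : Matrix ι ι ℂ)).trace.re = a}

/-- `P` is an `S`-full projector: an orthogonal projector with `P L(A) P ⊆ S`. -/
structure IsFullProjector (S : Submodule ℂ (Matrix ι ι ℂ)) (P : Matrix ι ι ℂ) : Prop where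
  isStarProjection : IsStarProjection P
  full : ∀ M : Matrix ι ι ℂ, P * M * P ∈ S

/-- `P` is maximal, in the Loewner order, among the `S`-full projectors. -/
structure IsMaximalFullProjector (S : Submodule ℂ (Matrix ι ι ℂ)) (P : Matrix ι ι ℂ) : Prop
    extends IsFullProjector S P where
  maximal : ∀ Q : Matrix ι ι ℂ, IsFullProjector S Q → (Q - P).PosSemidef → Q = P

end ThetaFacet

end

noncomputable section

namespace ThetaFacet

open Matrix

variable {ι : Type*} [Fintype ι] [DecidableEq ι]

/-! Call W = M M† a unit weight when some Y ∈ S ⊗ L(B) satisfies Tr_A Y ≤ I and Y ≥ |M⟩⟨M|. Unit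
weights cut out TH(S) inside the positive cone (`mem_thetaBody_iff`) and form a compact set. By
separation, any Hermitian V with Tr(XV) ≤ 1 on TH(S) is therefore dominated by a convex combination
of unit weights (`exists_mem_convexHull_unitWeights`).

A facet F on the hyperplane Tr(XV) = 1 spans Herm(A) over the reals, because that hyperplane misses
the origin. Every unit weight occurring in the combination is saturated on F, and spanning forces it
to equal V. So V = M M† is itself a unit weight.

Let |N⟩⟨N| lie below the slack Y - |M⟩⟨M|. Rotating M towards N keeps the same Y feasible, so
first-order optimality at each X ∈ F gives Tr(X N M†) = 0, whence N M† = 0. Conjugating Y on B by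
(M†)ᵀ thus removes the slack and leaves |V⟩⟨V| ∈ S ⊗ L(B), which says V L(A) V ⊆ S
(`mul_mul_mem_of_facet_normal`). The support projector of V is then S-full, hence a unit weight, and
it dominates V. Saturation on F makes it equal to V, and the same argument gives maximality.

A supporting hyperplane through the origin would have a positive semidefinite normal Q up to sign,
with XQ = 0 on F. For n > 1 this confines F to too small a space
(`not_isFacet_of_trace_mul_eq_zero`). -/

/-! ### Square roots, traces and positivity -/

theorem continuousOn_spectrum_real {κ : Type*} [Fintype κ] [DecidableEq κ] (W : Matrix κ κ ℂ)
    (f : ℝ → ℝ) : ContinuousOn f (spectrum ℝ W) :=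
  W.finite_real_spectrum.continuousOn f

/-- A positive square root differs from any other square root by a contraction. -/
theorem exists_sqrt_eq_mul {W L : Matrix ι ι ℂ} (hL : W = L * Lᴴ) :
    ∃ C : Matrix ι ι ℂ, CFC.sqrt W = L * C ∧ (1 - Cᴴ * C).PosSemidef := by
  have hW : W.PosSemidef := hL ▸ posSemidef_self_mul_conjTranspose L
  have hW0 : 0 ≤ W := nonneg_iff_posSemidef.mpr hW
  have hsa : IsSelfAdjoint W := IsSelfAdjoint.of_nonneg hW0
  set g : Matrix ι ι ℂ := cfc (fun x : ℝ => (√x)⁻¹) W with hg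
  have hgsa : gᴴ = g := IsSelfAdjoint.star_eq (cfc_predicate _ W)
  have hid : cfc (fun x : ℝ => x) W = W := cfc_id' ℝ W
  have hc := continuousOn_spectrum_real W
  -- C = L† W^(-1/2), with the convention 0⁻¹ = 0; then C†C is the support projector of W.
  refine ⟨Lᴴ * g, ?_, ?_⟩
  · rw [← mul_assoc, ← hL, CFC.sqrt_eq_real_sqrt W, cfcₙ_eq_cfc]
    conv_rhs => rw [← hid]
    rw [hg, ← cfc_mul _ _ W (hc _) (hc _)]
    refine cfc_congr fun x hx => ?_
    have hx0 : 0 ≤ x := spectrum_nonneg_of_nonneg hW0 hx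
    have := Real.mul_self_sqrt hx0
    by_cases h : √x = 0
    · simp [h]
    · field_simp; simpa [sq] using this
  · have : (Lᴴ * g)ᴴ * (Lᴴ * g) = cfc (fun x : ℝ => (√x)⁻¹ * x * (√x)⁻¹) W := by
      rw [cfc_mul _ _ W (hc _) (hc _), cfc_mul _ _ W (hc _) (hc _), hid, ← hg]
      rw [conjTranspose_mul, conjTranspose_conjTranspose, hgsa, mul_assoc, ← mul_assoc L, ← hL,
        mul_assoc]
    rw [this]
    refine le_iff.mp (cfc_le_one _ _ fun x hx => ?_)
    have hx0 : 0 ≤ x := spectrum_nonneg_of_nonneg hW0 hx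
    have := Real.mul_self_sqrt hx0
    by_cases h : √x = 0
    · simp [h]
    · field_simp; simp [sq, this]

theorem trace_mul_nonneg {X P : Matrix ι ι ℂ} (hX : X.PosSemidef) (hP : P.PosSemidef) :
    0 ≤ (X * P).trace := by
  obtain ⟨hs, hs2⟩ := sqrt_spec hP
  have h := (hX.conjTranspose_mul_mul_same (CFC.sqrt P)).trace_nonneg
  rw [hs.isHermitian.eq] at h
  rwa [← hs2, ← mul_assoc, trace_mul_comm, ← mul_assoc]

theorem trace_mul_re_nonneg {X P : Matrix ι ι ℂ} (hX : X.PosSemidef) (hP : P.PosSemidef) :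
    0 ≤ (X * P).trace.re :=
  (Complex.nonneg_iff.mp (trace_mul_nonneg hX hP)).1

theorem trace_mul_vecMulVec_star {κ : Type*} [Fintype κ] (X : Matrix κ κ ℂ) (x : κ → ℂ) :
    (X * vecMulVec x (star x)).trace = star x ⬝ᵥ X *ᵥ x := by
  rw [mul_vecMulVec, trace_vecMulVec, dotProduct_comm]

theorem trace_mul_conj_of_isHermitian {κ : Type*} [Fintype κ] {X A : Matrix κ κ ℂ} (hX : X.IsHermitian)
    (hA : A.IsHermitian) : star (X * A).trace = (X * A).trace := by
  rw [← trace_conjTranspose, conjTranspose_mul, hX.eq, hA.eq, trace_mul_comm]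

theorem trace_mul_im_of_isHermitian {κ : Type*} [Fintype κ] {X A : Matrix κ κ ℂ} (hX : X.IsHermitian)
    (hA : A.IsHermitian) : (X * A).trace.im = 0 :=
  Complex.conj_eq_iff_im.mp (trace_mul_conj_of_isHermitian hX hA)

theorem posSemidef_of_trace_mul_re_nonneg {κ : Type*} [Fintype κ] {X : Matrix κ κ ℂ}
    (hX : X.IsHermitian) (h : ∀ P : Matrix κ κ ℂ, P.PosSemidef → 0 ≤ (X * P).trace.re) : X.PosSemidef := by
  refine .of_dotProduct_mulVec_nonneg hX fun x => ?_
  rw [← trace_mul_vecMulVec_star, Complex.nonneg_iff]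
  have hP := posSemidef_vecMulVec_self_star x
  exact ⟨h _ hP, (trace_mul_im_of_isHermitian hX hP.isHermitian).symm⟩

/-- `X P = 0` for positive semidefinite `X`, `P` with `Tr(XP) = 0`. -/
theorem mul_eq_zero_of_trace_mul_re_eq_zero {X P : Matrix ι ι ℂ} (hX : X.PosSemidef)
    (hP : P.PosSemidef) (h : (X * P).trace.re = 0) : X * P = 0 := by
  obtain ⟨hs, hs2⟩ := sqrt_spec hP
  obtain ⟨ht, ht2⟩ := sqrt_spec hX
  set s := CFC.sqrt P
  set t := CFC.sqrt X
  have h0 : (X * P).trace = 0 := by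
    rw [Complex.ext_iff]
    exact ⟨h, trace_mul_im_of_isHermitian hX.isHermitian hP.isHermitian⟩
  have : ((t * s)ᴴ * (t * s)).trace = 0 := by
    rw [conjTranspose_mul, hs.isHermitian.eq, ht.isHermitian.eq, ← h0, trace_mul_comm]
    rw [← hs2, ← ht2, trace_mul_comm]
    rw [show s * t * (t * s) = (s * (t * t)) * s by simp only [mul_assoc], trace_mul_comm,
      trace_mul_comm (t * t)]
    simp only [mul_assoc]
  have h1 : t * s = 0 := trace_conjTranspose_mul_self_eq_zero_iff.mp this
  rw [← hs2, ← ht2, show t * t * (s * s) = t * (t * s) * s by simp only [mul_assoc], h1]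
  simp

/-- The two orthogonal combinations of vectors `v`, `w` have ketbras dominated by the sum. -/
theorem posSemidef_ketBra_add_sub {κ : Type*} [Fintype κ] (v w : κ → ℂ) {a b : ℂ}
    (hab : star a * a + star b * b = 1) :
    (vecMulVec v (star v) + vecMulVec w (star w) -
      vecMulVec (a • v + b • w) (star (a • v + b • w))).PosSemidef := by
  have : vecMulVec v (star v) + vecMulVec w (star w) -
      vecMulVec (a • v + b • w) (star (a • v + b • w)) =
      vecMulVec (star b • v - star a • w) (star (star b • v - star a • w)) := by
    ext i j
    simp only [vecMulVec_apply, Matrix.add_apply, Matrix.sub_apply, Pi.add_apply, Pi.smul_apply,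
      Pi.star_apply, smul_eq_mul, star_add, star_mul, Pi.sub_apply, star_sub, star_star]
    linear_combination (-(v i * star (v j)) - w i * star (w j)) * hab
  rw [this]
  exact posSemidef_vecMulVec_self_star _

theorem isClosed_posSemidef {κ : Type*} [Fintype κ] :
    IsClosed {A : Matrix κ κ ℂ | A.PosSemidef} := by
  have : {A : Matrix κ κ ℂ | A.PosSemidef} =
      {A | Aᴴ = A} ∩ ⋂ x : κ → ℂ, {A | 0 ≤ star x ⬝ᵥ A *ᵥ x} := by
    ext A
    simp [posSemidef_iff_dotProduct_mulVec, IsHermitian]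
  rw [this]
  refine (isClosed_eq (by fun_prop) continuous_id).inter (isClosed_iInter fun x => ?_)
  exact isClosed_le continuous_const (by fun_prop)

theorem smul_posSemidef {κ : Type*} [Fintype κ] {A : Matrix κ κ ℂ} (hA : A.PosSemidef) {r : ℝ}
    (hr : 0 ≤ r) : ((r : ℂ) • A).PosSemidef :=
  hA.smul (by exact_mod_cast hr)

/-! ### Vectorized operators, partial trace and S ⊗ L(B) -/

theorem ketBra_vectorize_apply (M : Matrix ι ι ℂ) (i j i' j' : ι) :
    ketBra (vectorize M) (i, j) (i', j') = M i j * star (M i' j') := by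
  simp [ketBra, vecMulVec_apply, vectorize_apply]

theorem one_kronecker_conj_apply (D : Matrix ι ι ℂ) (Y : Matrix (ι × ι) (ι × ι) ℂ)
    (i j i' j' : ι) :
    (((1 : Matrix ι ι ℂ) ⊗ₖ D) * Y * ((1 : Matrix ι ι ℂ) ⊗ₖ D)ᴴ) (i, j) (i', j') =
      (D * (of fun k l => Y (i, k) (i', l)) * Dᴴ) j j' := by
  simp only [mul_apply, Fintype.sum_prod_type, one_apply, kroneckerMap_apply, conjTranspose_apply,
    ite_mul, one_mul, zero_mul, of_apply]
  rw [Finset.sum_comm]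
  simp [apply_ite (starRingEnd ℂ)]

theorem partialTraceA_eq_sum {κ : Type*} [Fintype κ] (Y : Matrix (κ × κ) (κ × κ) ℂ) :
    partialTraceA Y = ∑ i, Y.submatrix (fun j => (i, j)) (fun j => (i, j)) := by
  ext j j'
  simp [partialTraceA, Matrix.sum_apply]

theorem partialTraceA_sub {κ : Type*} [Fintype κ] (Y Z : Matrix (κ × κ) (κ × κ) ℂ) :
    partialTraceA (Y - Z) = partialTraceA Y - partialTraceA Z := by
  simp [partialTraceA_eq_sum, submatrix_sub, Finset.sum_sub_distrib]

theorem partialTraceA_smul {κ : Type*} [Fintype κ] (c : ℂ) (Y : Matrix (κ × κ) (κ × κ) ℂ) :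
    partialTraceA (c • Y) = c • partialTraceA Y := by
  simp [partialTraceA_eq_sum, submatrix_smul, Finset.smul_sum]

theorem PosSemidef.partialTraceA {κ : Type*} [Fintype κ] {Y : Matrix (κ × κ) (κ × κ) ℂ} (hY : Y.PosSemidef) :
    (partialTraceA Y).PosSemidef := by
  rw [partialTraceA_eq_sum]
  exact posSemidef_sum _ fun i _ => hY.submatrix _

theorem trace_partialTraceA {κ : Type*} [Fintype κ] (Y : Matrix (κ × κ) (κ × κ) ℂ) :
    (partialTraceA Y).trace = Y.trace := by
  simp only [trace, diag, partialTraceA, of_apply, Fintype.sum_prod_type]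
  exact Finset.sum_comm

theorem partialTraceA_ketBra_vectorize (M : Matrix ι ι ℂ) :
    partialTraceA (ketBra (vectorize M)) = (Mᴴ * M)ᵀ := by
  ext j j'
  simp [partialTraceA, ketBra_vectorize_apply, mul_apply, mul_comm]

theorem partialTraceA_one_kronecker_conj (D : Matrix ι ι ℂ) (Y : Matrix (ι × ι) (ι × ι) ℂ) :
    partialTraceA (((1 : Matrix ι ι ℂ) ⊗ₖ D) * Y * ((1 : Matrix ι ι ℂ) ⊗ₖ D)ᴴ) = D * partialTraceA Y * Dᴴ := by
  ext j j'
  rw [partialTraceA_eq_sum Y, Finset.mul_sum, Finset.sum_mul, Matrix.sum_apply]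
  simp only [partialTraceA, of_apply, one_kronecker_conj_apply]
  rfl

theorem one_kronecker_conj_ketBra_vectorize (D M : Matrix ι ι ℂ) :
    ((1 : Matrix ι ι ℂ) ⊗ₖ D) * ketBra (vectorize M) * ((1 : Matrix ι ι ℂ) ⊗ₖ D)ᴴ = ketBra (vectorize (M * Dᵀ)) := by
  ext ⟨i, j⟩ ⟨i', j'⟩
  rw [one_kronecker_conj_apply, ketBra_vectorize_apply]
  have : (of fun k l => ketBra (vectorize M) (i, k) (i', l)) = vecMulVec (M i) (star (M i')) := by
    ext k l
    simp [ketBra_vectorize_apply, vecMulVec_apply]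
  rw [this, mul_vecMulVec, vecMulVec_mul, vecMulVec_apply]
  simp [mul_apply, mulVec, vecMul, dotProduct, mul_comm]

theorem one_kronecker_conj_mem_tensorFull {S : Submodule ℂ (Matrix ι ι ℂ)} (D : Matrix ι ι ℂ)
    {Y : Matrix (ι × ι) (ι × ι) ℂ} (hY : Y ∈ tensorFull S) :
    ((1 : Matrix ι ι ℂ) ⊗ₖ D) * Y * ((1 : Matrix ι ι ℂ) ⊗ₖ D)ᴴ ∈ tensorFull S := by
  induction hY using Submodule.span_induction with
  | mem Y hY =>
    obtain ⟨A, hA, B, rfl⟩ := hY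
    refine Submodule.subset_span ⟨A, hA, D * B * Dᴴ, ?_⟩
    rw [conjTranspose_kronecker, ← mul_kronecker_mul, ← mul_kronecker_mul]
    simp
  | zero => simp
  | add Y Z _ _ hY hZ => rw [mul_add, add_mul]; exact add_mem hY hZ
  | smul c Y _ hY => rw [Matrix.mul_smul, Matrix.smul_mul]; exact Submodule.smul_mem _ c hY

theorem block_mem_of_mem_tensorFull {κ : Type*} {S : Submodule ℂ (Matrix κ κ ℂ)}
    {Y : Matrix (κ × κ) (κ × κ) ℂ} (hY : Y ∈ tensorFull S) (j j' : κ) :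
    Y.submatrix (fun i => (i, j)) (fun i => (i, j')) ∈ S := by
  induction hY using Submodule.span_induction with
  | mem Y hY =>
    obtain ⟨A, hA, B, rfl⟩ := hY
    convert S.smul_mem (B j j') hA using 1
    ext i i'
    simp [mul_comm]
  | zero => exact S.zero_mem
  | add Y Z _ _ hY hZ => exact add_mem hY hZ
  | smul c Y _ hY => exact S.smul_mem c hY

/-- The blocks of |L⟩⟨L| along B are the operators L|j⟩⟨j'|L†, and these span L L(A) L†. The next
lemma is the converse. -/
theorem mul_mul_mem_of_ketBra_mem_tensorFull {S : Submodule ℂ (Matrix ι ι ℂ)}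
    {L : Matrix ι ι ℂ} (h : ketBra (vectorize L) ∈ tensorFull S) (M : Matrix ι ι ℂ) :
    L * M * Lᴴ ∈ S := by
  have hM : L * M * Lᴴ = ∑ j, ∑ j', M j j' •
      (ketBra (vectorize L)).submatrix (fun i => (i, j)) (fun i => (i, j')) := by
    ext i i'
    simp only [mul_apply, Matrix.sum_apply, Matrix.smul_apply, submatrix_apply, ketBra_vectorize_apply,
      conjTranspose_apply, Finset.sum_mul, smul_eq_mul]
    rw [Finset.sum_comm]
    exact Finset.sum_congr rfl fun j _ => Finset.sum_congr rfl fun j' _ => by ring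
  rw [hM]
  exact sum_mem fun j _ => sum_mem fun j' _ => S.smul_mem _ (block_mem_of_mem_tensorFull h j j')

theorem ketBra_mem_tensorFull {S : Submodule ℂ (Matrix ι ι ℂ)}
    {L : Matrix ι ι ℂ} (h : ∀ M, L * M * Lᴴ ∈ S) : ketBra (vectorize L) ∈ tensorFull S := by
  have hL : ketBra (vectorize L) =
      ∑ j, ∑ j', (L * single j j' 1 * Lᴴ) ⊗ₖ (single j j' (1 : ℂ)) := by
    ext ⟨i, k⟩ ⟨i', k'⟩
    simp [ketBra_vectorize_apply, Matrix.sum_apply, mul_apply, single_apply, ite_and]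
  rw [hL]
  exact sum_mem fun j _ => sum_mem fun j' _ => Submodule.subset_span ⟨_, h _, _, rfl⟩

/-! ### Unit weights -/

/-- `Y` is feasible, with value one, in the program of the weighted theta function with
`√W` replaced by `M`. -/
structure IsUnitFeasible (S : Submodule ℂ (Matrix ι ι ℂ)) (M : Matrix ι ι ℂ)
    (Y : Matrix (ι × ι) (ι × ι) ℂ) : Prop where
  mem : Y ∈ tensorFull S
  partialTrace_le : (1 - partialTraceA Y).PosSemidef
  ketBra_le : (Y - ketBra (vectorize M)).PosSemidef

/-- The weights `M M†` of all unit feasible pairs. -/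
def unitWeights (S : Submodule ℂ (Matrix ι ι ℂ)) : Set (Matrix ι ι ℂ) :=
  {W | ∃ M Y, IsUnitFeasible S M Y ∧ W = M * Mᴴ}

theorem posSemidef_ketBra {κ : Type*} [Fintype κ] [DecidableEq κ] (v : κ × κ → ℂ) :
    (ketBra v).PosSemidef :=
  posSemidef_vecMulVec_self_star v

theorem IsUnitFeasible.posSemidef {S : Submodule ℂ (Matrix ι ι ℂ)} {M : Matrix ι ι ℂ}
    {Y : Matrix (ι × ι) (ι × ι) ℂ} (h : IsUnitFeasible S M Y) : Y.PosSemidef := by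
  simpa using h.ketBra_le.add (posSemidef_ketBra (vectorize M))

theorem IsUnitFeasible.conjTranspose_mul_self_le {S : Submodule ℂ (Matrix ι ι ℂ)}
    {M : Matrix ι ι ℂ} {Y : Matrix (ι × ι) (ι × ι) ℂ} (h : IsUnitFeasible S M Y) :
    (1 - Mᴴ * M).PosSemidef := by
  have h1 := h.partialTrace_le.add (PosSemidef.partialTraceA h.ketBra_le)
  rw [partialTraceA_sub, partialTraceA_ketBra_vectorize] at h1
  simpa using h1.transpose

/-- Conjugation on B preserves S ⊗ L(B) and acts on vectorizations as right multiplication. The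
partial trace becomes at most CᵀCᵀ† = (C†C)ᵀ ≤ I. -/
theorem IsUnitFeasible.mul_contraction {S : Submodule ℂ (Matrix ι ι ℂ)}
    {M : Matrix ι ι ℂ} {Y : Matrix (ι × ι) (ι × ι) ℂ} (h : IsUnitFeasible S M Y)
    {C : Matrix ι ι ℂ} (hC : (1 - Cᴴ * C).PosSemidef) :
    IsUnitFeasible S (M * C) ((1 ⊗ₖ Cᵀ) * Y * (1 ⊗ₖ Cᵀ)ᴴ) where
  mem := one_kronecker_conj_mem_tensorFull _ h.mem
  partialTrace_le := by
    rw [partialTraceA_one_kronecker_conj]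
    have h1 := h.partialTrace_le.mul_mul_conjTranspose_same Cᵀ
    have h2 := hC.transpose.add h1
    have h3 : Cᵀ * Cᵀᴴ = (Cᴴ * C)ᵀ := by
      rw [transpose_mul]; rfl
    rw [mul_sub, sub_mul, mul_one, h3, transpose_sub, transpose_one, sub_add_sub_cancel] at h2
    exact h2
  ketBra_le := by
    have := h.ketBra_le.mul_mul_conjTranspose_same ((1 : Matrix ι ι ℂ) ⊗ₖ Cᵀ)
    rwa [mul_sub, sub_mul, one_kronecker_conj_ketBra_vectorize, transpose_transpose] at this

/-- Allowing any M with W = M M† in place of √W costs nothing, since √W = M C for a contraction C.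
-/
theorem one_mem_thetaFeasible {S : Submodule ℂ (Matrix ι ι ℂ)} {W : Matrix ι ι ℂ}
    (hW : W ∈ unitWeights S) : 1 ∈ thetaFeasible S W := by
  obtain ⟨M, Y, h, hM⟩ := hW
  obtain ⟨C, hC, hC1⟩ := exists_sqrt_eq_mul hM
  have h' := h.mul_contraction hC1
  refine ⟨_, h'.mem, ?_, ?_⟩
  · simpa using h'.partialTrace_le
  · rw [hC]; exact h'.ketBra_le

theorem posSemidef_of_mem_unitWeights {S : Submodule ℂ (Matrix ι ι ℂ)} {W : Matrix ι ι ℂ}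
    (hW : W ∈ unitWeights S) : W.PosSemidef := by
  obtain ⟨M, Y, h, rfl⟩ := hW
  exact posSemidef_self_mul_conjTranspose M

/-- The partial trace bounds M†M rather than M M†; passing to the self-adjoint root √W removes the
difference. -/
theorem le_one_of_mem_unitWeights {S : Submodule ℂ (Matrix ι ι ℂ)} {W : Matrix ι ι ℂ}
    (hW : W ∈ unitWeights S) : (1 - W).PosSemidef := by
  have hW' := posSemidef_of_mem_unitWeights hW
  obtain ⟨M, Y, h, hM⟩ := hW
  obtain ⟨C, hC, hC1⟩ := exists_sqrt_eq_mul hM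
  have h1 := (h.mul_contraction hC1).conjTranspose_mul_self_le
  rw [← hC] at h1
  obtain ⟨hs, hs2⟩ := sqrt_spec hW'
  rwa [hs.isHermitian.eq, hs2] at h1

theorem zero_mem_unitWeights (S : Submodule ℂ (Matrix ι ι ℂ)) : 0 ∈ unitWeights S := by
  have h0 : vectorize (0 : Matrix ι ι ℂ) = 0 := by ext ⟨i, j⟩; simp [vectorize_apply]
  refine ⟨0, 0, ⟨zero_mem _, ?_, ?_⟩, by simp⟩
  · simpa [partialTraceA_eq_sum] using PosSemidef.one
  · simpa [h0, ketBra] using PosSemidef.zero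

/-- The squares of the contractions `L` with `L L(A) L† ⊆ S` are admissible weights. -/
theorem mul_conjTranspose_mem_unitWeights {S : Submodule ℂ (Matrix ι ι ℂ)} {L : Matrix ι ι ℂ}
    (hL : (1 - Lᴴ * L).PosSemidef) (h : ∀ M, L * M * Lᴴ ∈ S) : L * Lᴴ ∈ unitWeights S := by
  refine ⟨L, ketBra (vectorize L), ⟨ketBra_mem_tensorFull h, ?_, ?_⟩, rfl⟩
  · rw [partialTraceA_ketBra_vectorize]
    simpa using hL.transpose
  · simpa using PosSemidef.zero

theorem IsFullProjector.mem_unitWeights {S : Submodule ℂ (Matrix ι ι ℂ)} {P : Matrix ι ι ℂ}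
    (hP : IsFullProjector S P) : P ∈ unitWeights S := by
  have hs : Pᴴ = P := hP.isStarProjection.isSelfAdjoint.star_eq
  have hi : P * P = P := hP.isStarProjection.isIdempotentElem
  have h1 : (1 - P).PosSemidef := by
    have := posSemidef_conjTranspose_mul_self (1 - P)
    rwa [conjTranspose_sub, hs, conjTranspose_one, mul_sub, mul_one, sub_mul, one_mul, hi, sub_self,
      sub_zero] at this
  have := mul_conjTranspose_mem_unitWeights (S := S) (L := P) (by rwa [hs, hi])
    (by rw [hs]; exact hP.full)
  rwa [hs, hi] at this

/-! ### The theta body in terms of unit weights -/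

theorem exists_smul_one_sub_posSemidef {κ : Type*} [Fintype κ] [DecidableEq κ]
    {A : Matrix κ κ ℂ} (hA : A.IsHermitian) :
    ∃ c : ℝ, 0 ≤ c ∧ ((c : ℂ) • (1 : Matrix κ κ ℂ) - A).PosSemidef := by
  obtain ⟨c, hc⟩ := A.finite_real_spectrum.bddAbove
  refine ⟨max c 0, le_max_right _ _, ?_⟩
  have h := le_algebraMap_of_spectrum_le (R := ℝ) (r := max c 0) (a := A)
    (fun x hx => (hc hx).trans (le_max_left _ _)) hA
  rw [Algebra.algebraMap_eq_smul_one] at h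
  have h' := le_iff.mp h
  have hc' : ((max c 0 : ℝ) : ℂ) • (1 : Matrix κ κ ℂ) = (max c 0 : ℝ) • 1 := by
    ext i j
    simp [Matrix.smul_apply]
  rw [hc']
  exact h'

/-- Since I ∈ S, a large multiple of the identity is feasible. This keeps `theta` from being the
default infimum of the empty set. -/
theorem thetaFeasible_nonempty {S : Submodule ℂ (Matrix ι ι ℂ)} (hS : IsNoncommGraph S)
    (W : Matrix ι ι ℂ) : (thetaFeasible S W).Nonempty := by
  obtain ⟨c, hc, h⟩ := exists_smul_one_sub_posSemidef
    (posSemidef_ketBra (vectorize (CFC.sqrt W))).isHermitian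
  have hmem : (c : ℂ) • (1 : Matrix (ι × ι) (ι × ι) ℂ) ∈ tensorFull S :=
    Submodule.smul_mem _ _ (Submodule.subset_span
      ⟨1, hS.one_mem, (1 : Matrix ι ι ℂ), one_kronecker_one.symm⟩)
  have hpos : ((c : ℂ) • (1 : Matrix (ι × ι) (ι × ι) ℂ)).PosSemidef :=
    smul_posSemidef PosSemidef.one hc
  obtain ⟨t, ht, h'⟩ := exists_smul_one_sub_posSemidef
    (PosSemidef.partialTraceA hpos).isHermitian
  exact ⟨t, _, hmem, h', h⟩

theorem nonneg_of_mem_thetaFeasible [Nonempty ι] {S : Submodule ℂ (Matrix ι ι ℂ)}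
    {W : Matrix ι ι ℂ} {t : ℝ} (ht : t ∈ thetaFeasible S W) : 0 ≤ t := by
  obtain ⟨Y, -, h1, h2⟩ := ht
  have hY : Y.PosSemidef := by simpa using h2.add (posSemidef_ketBra (vectorize (CFC.sqrt W)))
  have h := (h1.add (PosSemidef.partialTraceA hY)).diag_nonneg (i := Classical.arbitrary ι)
  simpa using h

theorem theta_le_one [Nonempty ι] {S : Submodule ℂ (Matrix ι ι ℂ)} {W : Matrix ι ι ℂ}
    (hW : W ∈ unitWeights S) : theta S W ≤ 1 :=
  csInf_le ⟨0, fun _ => nonneg_of_mem_thetaFeasible⟩ (one_mem_thetaFeasible hW)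

theorem smul_mem_unitWeights {S : Submodule ℂ (Matrix ι ι ℂ)} {W : Matrix ι ι ℂ} {t : ℝ}
    (hW : W.PosSemidef) (h : t ∈ thetaFeasible S W) (ht : 0 < t) :
    ((t⁻¹ : ℝ) : ℂ) • W ∈ unitWeights S := by
  obtain ⟨Y, hY, h1, h2⟩ := h
  obtain ⟨hs, hs2⟩ := sqrt_spec hW
  have hr : (√t⁻¹ : ℂ) * √t⁻¹ = ((t⁻¹ : ℝ) : ℂ) := by
    rw [← Complex.ofReal_mul, Real.mul_self_sqrt (by positivity)]
  refine ⟨(√t⁻¹ : ℂ) • CFC.sqrt W, ((t⁻¹ : ℝ) : ℂ) • Y, ⟨Submodule.smul_mem _ _ hY, ?_, ?_⟩, ?_⟩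
  · have h3 := smul_posSemidef h1 (r := t⁻¹) (by positivity)
    rwa [smul_sub, smul_smul, ← Complex.ofReal_mul, inv_mul_cancel₀ ht.ne', Complex.ofReal_one,
      one_smul, ← partialTraceA_smul] at h3
  · have h3 := smul_posSemidef h2 (r := t⁻¹) (by positivity)
    convert h3 using 1
    ext ⟨i, j⟩ ⟨i', j'⟩
    simp only [Matrix.sub_apply, Matrix.smul_apply, ketBra_vectorize_apply, smul_eq_mul, star_mul,
      ← hr]
    rw [show star (√t⁻¹ : ℂ) = √t⁻¹ from Complex.conj_ofReal _]
    ring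
  · rw [conjTranspose_smul, Matrix.smul_mul, Matrix.mul_smul, smul_smul, hs.isHermitian.eq, hs2]
    rw [show star (√t⁻¹ : ℂ) = √t⁻¹ from Complex.conj_ofReal _, hr]

/-- A weight with feasible value t > 0 becomes a unit weight after division by t. Values t < 1 + δ
suffice, so attainment of the infimum is not needed. -/
theorem mem_thetaBody_iff [Nonempty ι] {S : Submodule ℂ (Matrix ι ι ℂ)} (hS : IsNoncommGraph S)
    {X : Herm ι} : X ∈ thetaBody S ↔ (X : Matrix ι ι ℂ).PosSemidef ∧
      ∀ W ∈ unitWeights S, ((X : Matrix ι ι ℂ) * W).trace.re ≤ 1 := by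
  refine ⟨fun h => ⟨h.1, fun W hW => h.2 W (posSemidef_of_mem_unitWeights hW) (theta_le_one hW)⟩,
    fun h => ⟨h.1, fun W hW hθ => ?_⟩⟩
  refine le_of_forall_pos_le_add fun δ hδ => ?_
  obtain ⟨t, ht, htδ⟩ := exists_lt_of_csInf_lt (thetaFeasible_nonempty hS W)
    (show sInf (thetaFeasible S W) < 1 + δ from hθ.trans_lt (by linarith))
  have ht0 := nonneg_of_mem_thetaFeasible ht
  -- At t = 0 division is impossible, but the same Y is also feasible with value 1 + δ.
  obtain rfl | ht0 := ht0.eq_or_lt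
  · obtain ⟨Y, hY, h1, h2⟩ := ht
    have h1' : (((1 + δ : ℝ) : ℂ) • (1 : Matrix ι ι ℂ) - partialTraceA Y).PosSemidef := by
      have := h1.add (smul_posSemidef PosSemidef.one (r := 1 + δ) (by linarith))
      convert this using 1
      simp [sub_eq_neg_add]
    have := h.2 _ (smul_mem_unitWeights hW ⟨Y, hY, h1', h2⟩ (by linarith))
    rw [Matrix.mul_smul, trace_smul, smul_eq_mul, Complex.re_ofReal_mul,
      inv_mul_le_iff₀ (by linarith)] at this
    linarith
  · have := h.2 _ (smul_mem_unitWeights hW ht ht0)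
    rw [Matrix.mul_smul, trace_smul, smul_eq_mul, Complex.re_ofReal_mul, inv_mul_le_iff₀ ht0] at this
    linarith

/-! ### Compactness -/

theorem isCompact_norm_apply_le {κ μ : Type*} [Fintype κ] [Fintype μ] (c : ℝ) :
    IsCompact {A : Matrix κ μ ℂ | ∀ i j, ‖A i j‖ ≤ c} := by
  have h : {A : Matrix κ μ ℂ | ∀ i j, ‖A i j‖ ≤ c} =
      Set.univ.pi fun _ : κ => Set.univ.pi fun _ : μ => Metric.closedBall (0 : ℂ) c := by
    exact Set.ext fun A => ⟨fun h i _ j _ => mem_closedBall_zero_iff.mpr (h i j),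
      fun h i j => mem_closedBall_zero_iff.mp (h i trivial j trivial)⟩
  rw [h]
  exact isCompact_univ_pi fun _ => isCompact_univ_pi fun _ => isCompact_closedBall _ _

theorem norm_sq_apply_le_conjTranspose_mul_self {κ μ : Type*} [Fintype κ] (A : Matrix κ μ ℂ)
    (i : κ) (j : μ) : ‖A i j‖ ^ 2 ≤ ((Aᴴ * A) j j).re := by
  simp only [mul_apply, conjTranspose_apply, Complex.re_sum]
  have h : ∀ k, (star (A k j) * A k j).re = ‖A k j‖ ^ 2 := fun k => by
    rw [← Complex.normSq_eq_norm_sq, Complex.normSq_apply]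
    simp
  simp only [h]
  exact Finset.single_le_sum (f := fun k => ‖A k j‖ ^ 2) (fun _ _ => sq_nonneg _)
    (Finset.mem_univ i)

theorem continuous_partialTraceA {κ : Type*} [Fintype κ] :
    Continuous (partialTraceA (ι := κ)) := by
  refine continuous_matrix fun j j' => ?_
  simp only [partialTraceA, of_apply]
  exact continuous_finsetSum _ fun i _ => continuous_id.matrix_elem _ _

theorem continuous_ketBra_vectorize :
    Continuous fun M : Matrix ι ι ℂ => ketBra (vectorize M) := by
  refine continuous_matrix fun ⟨i, j⟩ ⟨i', j'⟩ => ?_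
  simp only [ketBra_vectorize_apply]
  exact (continuous_id.matrix_elem _ _).mul (continuous_id.matrix_elem _ _).star

theorem isClosed_isUnitFeasible (S : Submodule ℂ (Matrix ι ι ℂ)) :
    IsClosed {p : Matrix ι ι ℂ × Matrix (ι × ι) (ι × ι) ℂ | IsUnitFeasible S p.1 (p.2ᴴ * p.2)} := by
  have hc : Continuous fun p : Matrix ι ι ℂ × Matrix (ι × ι) (ι × ι) ℂ => p.2ᴴ * p.2 := by fun_prop
  have h1 := (tensorFull S).closed_of_finiteDimensional.preimage hc
  have h2 := isClosed_posSemidef.preimage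
    ((continuous_const (y := (1 : Matrix ι ι ℂ))).sub (continuous_partialTraceA.comp hc))
  have h3 := isClosed_posSemidef.preimage
    (hc.sub (continuous_ketBra_vectorize.comp continuous_fst))
  convert h1.inter (h2.inter h3) using 1
  ext p
  exact ⟨fun h => ⟨h.1, h.2, h.3⟩, fun h => ⟨h.1, h.2.1, h.2.2⟩⟩

theorem isCompact_unitWeights (S : Submodule ℂ (Matrix ι ι ℂ)) : IsCompact (unitWeights S) := by
  -- Writing Y = Z†Z, the squared entries of M are at most 1 and those of Z at most Tr Y ≤ n; both
  -- are below (1 + n)².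
  set c : ℝ := 1 + Fintype.card ι
  have hcpt : IsCompact {p : Matrix ι ι ℂ × Matrix (ι × ι) (ι × ι) ℂ |
      IsUnitFeasible S p.1 (p.2ᴴ * p.2)} := by
    refine ((isCompact_norm_apply_le c).prod (isCompact_norm_apply_le c)).of_isClosed_subset
      (isClosed_isUnitFeasible S) fun p hp => ⟨fun i j => ?_, fun i j => ?_⟩
    · have h1 := norm_sq_apply_le_conjTranspose_mul_self p.1 i j
      have h2 := (Complex.nonneg_iff.mp (hp.conjTranspose_mul_self_le.diag_nonneg (i := j))).1
      simp only [Matrix.sub_apply, one_apply_eq, Complex.sub_re, Complex.one_re] at h2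
      have : (0 : ℝ) ≤ Fintype.card ι := by positivity
      refine abs_le_of_sq_le_sq' (b := c) ?_ (by positivity) |>.2
      nlinarith
    · have h1 := norm_sq_apply_le_conjTranspose_mul_self p.2 i j
      have h2 := (Complex.nonneg_iff.mp hp.partialTrace_le.trace_nonneg).1
      rw [trace_sub, trace_partialTraceA, trace_one] at h2
      have h3 : ((p.2ᴴ * p.2) j j).re ≤ (p.2ᴴ * p.2).trace.re := by
        simp only [trace, diag, Complex.re_sum]
        exact Finset.single_le_sum (f := fun k => ((p.2ᴴ * p.2) k k).re)
          (fun k _ => (Complex.nonneg_iff.mp hp.posSemidef.diag_nonneg).1) (Finset.mem_univ j)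
      simp only [Complex.sub_re, Complex.natCast_re] at h2
      have : (0 : ℝ) ≤ Fintype.card ι := by positivity
      refine abs_le_of_sq_le_sq' (b := c) ?_ (by positivity) |>.2
      nlinarith
  convert hcpt.image (f := fun p => p.1 * p.1ᴴ) (by fun_prop) using 1
  ext W
  constructor
  · rintro ⟨M, Y, h, rfl⟩
    obtain ⟨hs, hs2⟩ := sqrt_spec h.posSemidef
    exact ⟨(M, CFC.sqrt Y), by simpa [hs.isHermitian.eq, hs2] using h, rfl⟩
  · rintro ⟨p, hp, rfl⟩
    exact ⟨p.1, _, hp, rfl⟩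

/-- The convex hull of a compact set in finite dimension is compact. -/
theorem isCompact_convexHull_of_finiteDimensional {E : Type*} [AddCommGroup E] [Module ℝ E]
    [TopologicalSpace E] [IsTopologicalAddGroup E] [ContinuousSMul ℝ E] [FiniteDimensional ℝ E]
    {K : Set E} (hK : IsCompact K) : IsCompact (convexHull ℝ K) := by
  -- By Carathéodory d points suffice, so the hull is the continuous image of simplex × K^d; shorter
  -- combinations are padded with zero weights.
  set d := Module.finrank ℝ E + 1
  have hc : IsCompact (stdSimplex ℝ (Fin d) ×ˢ (Set.univ.pi fun _ : Fin d => K)) :=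
    (isCompact_stdSimplex ℝ _).prod (isCompact_univ_pi fun _ => hK)
  convert hc.image (f := fun p => ∑ i, p.1 i • p.2 i) (by fun_prop) using 1
  ext x
  constructor
  · intro hx
    obtain ⟨κ, _, z, w, hz, hind, hw, hw1, rfl⟩ := eq_pos_convex_span_of_mem_convexHull hx
    have hcard : Fintype.card κ ≤ d := hind.card_le_finrank_succ.trans
      (Nat.succ_le_succ (Submodule.finrank_le _))
    obtain ⟨e⟩ : Nonempty (κ ↪ Fin d) := Function.Embedding.nonempty_of_card_le (by simpa using hcard)
    have hne : Nonempty κ := by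
      by_contra h
      rw [not_nonempty_iff] at h
      simp at hw1
    have hinv : ∀ i, Function.invFun e (e i) = i := Function.leftInverse_invFun e.injective
    refine ⟨(fun j => if j ∈ Set.range e then w (Function.invFun e j) else 0,
      fun j => z (Function.invFun e j)), ⟨⟨fun j => ?_, ?_⟩, fun j _ => hz ⟨_, rfl⟩⟩, ?_⟩
    · dsimp only; split_ifs; exacts [(hw _).le, le_rfl]
    · rw [← hw1]
      exact (Fintype.sum_of_injective e e.injective _ _ (fun j hj => if_neg hj)
        fun i => by simp [hinv]).symm
    · exact (Fintype.sum_of_injective e e.injective _ _ (fun j hj => by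
        dsimp only; rw [if_neg hj, zero_smul])
        fun i => by simp [hinv]).symm
  · rintro ⟨⟨w, z⟩, ⟨hw, hz⟩, rfl⟩
    exact mem_convexHull_of_exists_fintype w z hw.1 hw.2 (fun i => hz i trivial) rfl

/-! ### Separation -/

/-- A real functional on matrices is, on Hermitian matrices, the trace against a Hermitian matrix. -/
theorem exists_isHermitian_trace_eq (f : Module.Dual ℝ (Matrix ι ι ℂ)) :
    ∃ X : Matrix ι ι ℂ, X.IsHermitian ∧ ∀ A : Matrix ι ι ℂ, A.IsHermitian →
      (X * A).trace.re = f A := by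
  set g : Module.Dual ℂ (Matrix ι ι ℂ) := f.extendRCLike with hg
  set G : Matrix ι ι ℂ := of fun i j => g (single j i 1) with hG
  have hgf : ∀ A, (g A).re = f A := fun A => Module.Dual.re_extendRCLike_apply (𝕜 := ℂ) f A
  have htr : ∀ A : Matrix ι ι ℂ, (G * A).trace = g A := fun A => by
    conv_rhs => rw [matrix_eq_sum_single A, map_sum]
    simp only [trace, diag, mul_apply, map_sum]
    rw [Finset.sum_comm]
    refine Finset.sum_congr rfl fun i _ => Finset.sum_congr rfl fun j _ => ?_
    rw [← mul_one (A i j), ← smul_eq_mul (A i j), ← smul_single, map_smul, smul_eq_mul, mul_comm,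
      smul_eq_mul, mul_one]
    rfl
  have htr' : ∀ A : Matrix ι ι ℂ, A.IsHermitian → (Gᴴ * A).trace.re = f A := fun A hA => by
    rw [← hgf, ← htr, trace_mul_comm G]
    nth_rewrite 1 [← hA.eq]
    rw [← conjTranspose_mul, trace_conjTranspose]
    exact Complex.conj_re _
  refine ⟨(1 / 2 : ℂ) • (G + Gᴴ), ?_, fun A hA => ?_⟩
  · rw [IsHermitian, conjTranspose_smul, conjTranspose_add, conjTranspose_conjTranspose, add_comm]
    simp
  · have h1 := htr' A hA
    have h2 := hgf A
    rw [← htr] at h2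
    rw [Matrix.smul_mul, add_mul, trace_smul, trace_add, smul_eq_mul,
      show (1 / 2 : ℂ) = ((1 / 2 : ℝ) : ℂ) by push_cast; rfl, Complex.re_ofReal_mul, Complex.add_re]
    linarith

theorem smul_real_eq_smul_complex {κ μ : Type*} (r : ℝ) (A : Matrix κ μ ℂ) :
    r • A = (r : ℂ) • A := by
  ext i j
  simp [Matrix.smul_apply]

theorem convex_posSemidef {κ : Type*} [Fintype κ] :
    Convex ℝ {A : Matrix κ κ ℂ | A.PosSemidef} := fun A hA B hB a b ha hb _ => by
  rw [Set.mem_ofPred_eq, smul_real_eq_smul_complex, smul_real_eq_smul_complex]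
  exact (smul_posSemidef hA ha).add (smul_posSemidef hB hb)

open scoped Pointwise in
/-- A half-space containing the theta body comes from a convex combination of admissible weights,
up to a positive semidefinite matrix. -/
theorem exists_mem_convexHull_unitWeights [Nonempty ι] {S : Submodule ℂ (Matrix ι ι ℂ)}
    (hS : IsNoncommGraph S) {V : Matrix ι ι ℂ} (hV : V.IsHermitian)
    (h : ∀ X ∈ thetaBody S, ((X : Matrix ι ι ℂ) * V).trace.re ≤ 1) :
    ∃ W ∈ convexHull ℝ (unitWeights S), (W - V).PosSemidef := by
  have : LocallyConvexSpace ℝ (Matrix ι ι ℂ) :=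
    inferInstanceAs (LocallyConvexSpace ℝ (ι → ι → ℂ))
  set N : Set (Matrix ι ι ℂ) := {A | (-A).PosSemidef} with hN
  have hNclosed : IsClosed N := isClosed_posSemidef.preimage continuous_neg
  have hNconv : Convex ℝ N := convex_posSemidef.neg
  have hclosed : IsClosed (convexHull ℝ (unitWeights S) + N) :=
    hNclosed.add_left_of_isCompact (isCompact_convexHull_of_finiteDimensional
      (isCompact_unitWeights S))
  have hconv := (convex_convexHull ℝ (unitWeights S)).add hNconv
  by_contra hcon
  have hVC : V ∉ convexHull ℝ (unitWeights S) + N := by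
    rintro ⟨W, hW, P, hP, rfl⟩
    exact hcon ⟨W, hW, by simpa [hN] using hP⟩
  obtain ⟨f, u, hf, hfV⟩ := geometric_hahn_banach_closed_point hconv hclosed hVC
  have hzero := subset_convexHull ℝ _ (zero_mem_unitWeights S)
  have hfW : ∀ W ∈ unitWeights S, f W < u := fun W hW => by
    have := hf _ (Set.add_mem_add (subset_convexHull ℝ _ hW) (show 0 ∈ N by
      simpa [hN] using PosSemidef.zero))
    rwa [add_zero] at this
  have hu : 0 < u := by simpa using hfW 0 (zero_mem_unitWeights S)
  -- If f P < 0, then f on the ray through -P in the cone N would reach u, at the multiple u / (-f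
  -- P).
  have hfP : ∀ P : Matrix ι ι ℂ, P.PosSemidef → 0 ≤ f P := fun P hP => by
    by_contra! hneg
    have hr : 0 ≤ u / -f P := div_nonneg hu.le (by linarith)
    have := hf _ (Set.add_mem_add hzero (show -((u / -f P : ℝ) • P) ∈ N by
      rw [hN, Set.mem_ofPred_eq, neg_neg, smul_real_eq_smul_complex]
      exact smul_posSemidef hP hr))
    rw [zero_add, map_neg, map_smul, smul_eq_mul] at this
    have h' : -(u / -f P * f P) = u := by
      have := hneg.ne
      field_simp
    linarith
  obtain ⟨X, hX, hXf⟩ := exists_isHermitian_trace_eq f.toLinearMap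
  have hXpos : X.PosSemidef := posSemidef_of_trace_mul_re_nonneg hX fun P hP => by
    rw [hXf P hP.isHermitian]
    exact hfP P hP
  have hXpos' : (((u⁻¹ : ℝ) : ℂ) • X).PosSemidef := smul_posSemidef hXpos (by positivity)
  have hval : ∀ A : Matrix ι ι ℂ, A.IsHermitian →
      ((((u⁻¹ : ℝ) : ℂ) • X) * A).trace.re = f A / u := fun A hA => by
    rw [Matrix.smul_mul, trace_smul, smul_eq_mul, Complex.re_ofReal_mul, hXf A hA, div_eq_inv_mul]
    rfl
  -- X/u represents f/u, so it lies in the theta body while its trace against V exceeds 1.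
  have hmem : (⟨((u⁻¹ : ℝ) : ℂ) • X, hXpos'.isHermitian⟩ : Herm ι) ∈ thetaBody S :=
    (mem_thetaBody_iff hS).mpr ⟨hXpos', fun W hW => by
      rw [hval W (posSemidef_of_mem_unitWeights hW).isHermitian, div_le_one hu]
      exact (hfW W hW).le⟩
  have := h _ hmem
  rw [hval V hV, div_le_one hu] at this
  linarith

/-! ### Dimension and span of a facet -/

instance instFiniteHerm : Module.Finite ℝ (Herm ι) :=
  inferInstanceAs (Module.Finite ℝ (selfAdjoint.submodule ℝ (Matrix ι ι ℂ)))

/-- L(A) is the real direct sum of its Hermitian and skew-Hermitian parts, which multiplication by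
-i identifies. -/
theorem finrank_herm : Module.finrank ℝ (Herm ι) = Module.finrank ℂ (Matrix ι ι ℂ) := by
  have hinj : Function.Injective (skewAdjoint.negISMul (A := Matrix ι ι ℂ)) := fun a b h => by
    have ha := skewAdjoint.I_smul_neg_I a
    rw [h, skewAdjoint.I_smul_neg_I] at ha
    exact Subtype.ext ha.symm
  have hsurj : Function.Surjective (skewAdjoint.negISMul (A := Matrix ι ι ℂ)) := fun a => by
    refine ⟨⟨Complex.I • (a : Matrix ι ι ℂ), ?_⟩, ?_⟩
    · rw [skewAdjoint.mem_iff, star_smul, a.2.star_eq]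
      simp
    · ext1
      simp [skewAdjoint.negISMul, smul_smul]
  have e2 := (StarModule.decomposeProdAdjoint ℝ (Matrix ι ι ℂ)).finrank_eq
  set e := LinearEquiv.ofBijective _ ⟨hinj, hsurj⟩
  have e3 := e.finrank_eq
  have : Module.Finite ℝ (skewAdjoint (Matrix ι ι ℂ)) := Module.Finite.equiv e.symm
  have e4 := Module.finrank_mul_finrank ℝ ℂ (Matrix ι ι ℂ)
  rw [Complex.finrank_real_complex] at e4
  rw [Module.finrank_prod, e3] at e2
  have key : ∀ m a b : ℕ, 2 * b = m → m = a + a → a = b := by omega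
  exact key _ _ _ e4 e2

/-- The real functional `X ↦ Re Tr(XA)` on Hermitian matrices. -/
def traceForm (A : Matrix ι ι ℂ) : Herm ι →ₗ[ℝ] ℝ where
  toFun X := ((X : Matrix ι ι ℂ) * A).trace.re
  map_add' X Y := by simp [add_mul]
  map_smul' r X := by simp

theorem traceForm_apply (A : Matrix ι ι ℂ) (X : Herm ι) :
    traceForm A X = ((X : Matrix ι ι ℂ) * A).trace.re := rfl

theorem direction_eq_ker {E : Type*} [AddCommGroup E] [Module ℝ E] [FiniteDimensional ℝ E]
    {F : Set E} (hdim : Module.finrank ℝ (affineSpan ℝ F).direction + 1 = Module.finrank ℝ E)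
    {f : E →ₗ[ℝ] ℝ} (hf : f ≠ 0) {a : ℝ} (hF : ∀ x ∈ F, f x = a) :
    (affineSpan ℝ F).direction = LinearMap.ker f := by
  have hle : (affineSpan ℝ F).direction ≤ LinearMap.ker f := by
    rw [direction_affineSpan, vectorSpan_def, Submodule.span_le]
    rintro _ ⟨x, hx, y, hy, rfl⟩
    simp [hF x hx, hF y hy]
  refine Submodule.eq_of_le_of_finrank_eq hle ?_
  have := Module.Dual.finrank_ker_add_one_of_ne_zero (f := f) hf
  omega

theorem mem_span_of_mem_direction {E : Type*} [AddCommGroup E] [Module ℝ E] {F : Set E} {x : E}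
    (hx : x ∈ (affineSpan ℝ F).direction) : x ∈ Submodule.span ℝ F := by
  rw [direction_affineSpan, vectorSpan_def] at hx
  refine Submodule.span_le.mpr ?_ hx
  rintro _ ⟨x, hx, y, hy, rfl⟩
  exact sub_mem (Submodule.subset_span hx) (Submodule.subset_span hy)

/-- The direction of F is all of ker f, and a point with f = 1 supplies the missing dimension. -/
theorem span_eq_top_of_hyperplane {E : Type*} [AddCommGroup E] [Module ℝ E]
    [FiniteDimensional ℝ E] {F : Set E} (hne : F.Nonempty)
    (hdim : Module.finrank ℝ (affineSpan ℝ F).direction + 1 = Module.finrank ℝ E)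
    {f : E →ₗ[ℝ] ℝ} (hF : ∀ x ∈ F, f x = 1) : Submodule.span ℝ F = ⊤ := by
  obtain ⟨x0, hx0⟩ := hne
  have hf : f ≠ 0 := by
    rintro rfl
    simpa using hF x0 hx0
  have hker := direction_eq_ker hdim hf hF
  rw [eq_top_iff]
  intro x _
  have h1 : x - f x • x0 ∈ (affineSpan ℝ F).direction := by
    rw [hker]
    simp [hF x0 hx0]
  have := add_mem (mem_span_of_mem_direction h1)
    (Submodule.smul_mem _ (f x) (Submodule.subset_span hx0))
  simpa using this

theorem eq_zero_of_trace_mul_herm_eq_zero {A : Matrix ι ι ℂ}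
    (h : ∀ X : Herm ι, ((X : Matrix ι ι ℂ) * A).trace = 0) : A = 0 := by
  refine ext_iff_trace_mul_left.mpr fun M => ?_
  rw [mul_zero, trace_zero, ← realPart_add_I_smul_imaginaryPart M, add_mul, Matrix.smul_mul,
    trace_add, trace_smul, h, h]
  simp

theorem eq_zero_of_span_eq_top {F : Set (Herm ι)} (hF : Submodule.span ℝ F = ⊤)
    {A : Matrix ι ι ℂ} (h : ∀ X ∈ F, ((X : Matrix ι ι ℂ) * A).trace = 0) : A = 0 := by
  refine eq_zero_of_trace_mul_herm_eq_zero fun X => ?_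
  have hX : X ∈ Submodule.span ℝ F := hF ▸ trivial
  induction hX using Submodule.span_induction with
  | mem X hX => exact h X hX
  | zero => simp
  | add X Y _ _ hX hY =>
    rw [AddSubgroup.coe_add, add_mul, trace_add, hX, hY, add_zero]
  | smul r X _ hX =>
    rw [selfAdjoint.val_smul, smul_real_eq_smul_complex, Matrix.smul_mul, trace_smul, hX, smul_zero]

theorem eq_of_span_eq_top {F : Set (Herm ι)} (hF : Submodule.span ℝ F = ⊤)
    {A B : Matrix ι ι ℂ} (hA : A.IsHermitian) (hB : B.IsHermitian)
    (h : ∀ X ∈ F, ((X : Matrix ι ι ℂ) * A).trace.re = ((X : Matrix ι ι ℂ) * B).trace.re) :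
    A = B := by
  refine sub_eq_zero.mp (eq_zero_of_span_eq_top hF fun X hX => ?_)
  rw [mul_sub, trace_sub, sub_eq_zero]
  have hX' : (X : Matrix ι ι ℂ).IsHermitian := X.2
  exact Complex.ext (h X hX) (by
    rw [trace_mul_im_of_isHermitian hX' hA, trace_mul_im_of_isHermitian hX' hB])

/-- A first-order condition: a nonpositive quadratic has no linear term. -/
theorem eq_zero_of_forall_quadratic_nonpos {k q : ℝ} (h : ∀ t : ℝ, t ^ 2 * k + 2 * t * q ≤ 0) :
    q = 0 := by
  have hk : 0 < |k| + 1 := by positivity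
  -- At this t the quadratic is a nonnegative multiple of q², with coefficient k + 2(|k| + 1) > 0 in
  -- the numerator.
  have h1 := h (q / (|k| + 1))
  have h2 : (q / (|k| + 1)) ^ 2 * k + 2 * (q / (|k| + 1)) * q =
      q ^ 2 * (k + 2 * (|k| + 1)) / (|k| + 1) ^ 2 := by
    field_simp
  rw [h2, div_le_iff₀ (by positivity), zero_mul] at h1
  have h3 := neg_abs_le k
  have h4 : 0 < k + 2 * (|k| + 1) := by linarith [abs_nonneg k]
  have h5 : q ^ 2 ≤ 0 := by
    by_contra! h6
    linarith [mul_pos h6 h4]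
  exact pow_eq_zero_iff two_ne_zero |>.mp (le_antisymm h5 (sq_nonneg q))

/-- The support projector of a positive semidefinite contraction dominates it, and has the
two-sided form `V K V`. -/
theorem exists_support_projection {V : Matrix ι ι ℂ} (hV : V.PosSemidef)
    (hV1 : (1 - V).PosSemidef) : ∃ P h : Matrix ι ι ℂ, IsStarProjection P ∧
      (P - V).PosSemidef ∧ P = V * h ∧ P = h * V := by
  have hV0 : 0 ≤ V := nonneg_iff_posSemidef.mpr hV
  have hsa : IsSelfAdjoint V := IsSelfAdjoint.of_nonneg hV0
  have hid : cfc (fun x : ℝ => x) V = V := cfc_id' ℝ V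
  have hc := continuousOn_spectrum_real V
  have hle : ∀ x ∈ spectrum ℝ V, x ≤ 1 := (CFC.le_one_iff (R := ℝ) V).mp (le_iff.mpr hV1)
  set p : ℝ → ℝ := fun x => if x = 0 then 0 else 1 with hp
  refine ⟨cfc p V, cfc (fun x : ℝ => x⁻¹) V, ⟨?_, cfc_predicate _ V⟩, ?_, ?_, ?_⟩
  · rw [IsIdempotentElem, ← cfc_mul _ _ V (hc _) (hc _)]
    exact cfc_congr fun x _ => by by_cases h : x = 0 <;> simp [hp, h]
  · have : cfc (fun x : ℝ => x) V ≤ cfc p V := cfc_mono (fun x hx => by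
      by_cases h : x = 0
      · simp [hp, h]
      · simpa [hp, h] using hle x hx) (hc _) (hc _)
    rw [hid] at this
    exact le_iff.mp this
  · have hh : V * cfc (fun x : ℝ => x⁻¹) V =
        cfc (fun x : ℝ => x) V * cfc (fun x : ℝ => x⁻¹) V := by rw [hid]
    rw [hh, ← cfc_mul _ _ V (hc _) (hc _)]
    exact cfc_congr fun x _ => by by_cases h : x = 0 <;> simp [hp, h]
  · have hh : cfc (fun x : ℝ => x⁻¹) V * V =
        cfc (fun x : ℝ => x⁻¹) V * cfc (fun x : ℝ => x) V := by rw [hid]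
    rw [hh, ← cfc_mul _ _ V (hc _) (hc _)]
    exact cfc_congr fun x _ => by by_cases h : x = 0 <;> simp [hp, h]

/-! ### The normal of a facet -/

section Facet

variable {S : Submodule ℂ (Matrix ι ι ℂ)} {F : Set (Herm ι)} {V : Matrix ι ι ℂ}

/-- An admissible weight that is saturated on a spanning family of the theta body is determined. -/
theorem eq_of_mem_unitWeights [Nonempty ι] (hS : IsNoncommGraph S) (hFT : F ⊆ thetaBody S)
    (hspan : Submodule.span ℝ F = ⊤) (hV : V.IsHermitian)
    (hF1 : ∀ X ∈ F, ((X : Matrix ι ι ℂ) * V).trace.re = 1) {W : Matrix ι ι ℂ}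
    (hW : W ∈ unitWeights S) (hW1 : ∀ X ∈ F, 1 ≤ ((X : Matrix ι ι ℂ) * W).trace.re) : W = V :=
  eq_of_span_eq_top hspan (posSemidef_of_mem_unitWeights hW).isHermitian hV fun X hX => by
    rw [hF1 X hX]
    exact le_antisymm (((mem_thetaBody_iff hS).mp (hFT hX)).2 W hW) (hW1 X hX)

theorem eq_of_mem_unitWeights_of_le [Nonempty ι] (hS : IsNoncommGraph S) (hFT : F ⊆ thetaBody S)
    (hspan : Submodule.span ℝ F = ⊤) (hV : V.IsHermitian)
    (hF1 : ∀ X ∈ F, ((X : Matrix ι ι ℂ) * V).trace.re = 1) {W : Matrix ι ι ℂ}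
    (hW : W ∈ unitWeights S) (hW1 : (W - V).PosSemidef) : W = V :=
  eq_of_mem_unitWeights hS hFT hspan hV hF1 hW fun X hX => by
    have h1 := trace_mul_re_nonneg (hFT hX).1 hW1
    rw [mul_sub, trace_sub, Complex.sub_re, hF1 X hX] at h1
    linarith

/-- On F a convex combination of values at most 1 is at least 1, so each term of positive weight
equals 1; that unit weight is then V. -/
theorem facet_normal_mem_unitWeights [Nonempty ι] (hS : IsNoncommGraph S)
    (hFT : F ⊆ thetaBody S) (hspan : Submodule.span ℝ F = ⊤) (hV : V.IsHermitian)
    (hF1 : ∀ X ∈ F, ((X : Matrix ι ι ℂ) * V).trace.re = 1)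
    (hle : ∀ X ∈ thetaBody S, ((X : Matrix ι ι ℂ) * V).trace.re ≤ 1) : V ∈ unitWeights S := by
  obtain ⟨W, hW, hWV⟩ := exists_mem_convexHull_unitWeights hS hV hle
  obtain ⟨κ, _, w, z, hw, hw1, hz, rfl⟩ := mem_convexHull_iff_exists_fintype.mp hW
  obtain ⟨k, -, hk⟩ : ∃ k ∈ Finset.univ, 0 < w k := by
    refine Finset.exists_lt_of_sum_lt (f := fun _ => (0 : ℝ)) (s := Finset.univ) ?_
    simp [hw1]
  refine eq_of_mem_unitWeights hS hFT hspan hV hF1 (hz k) (fun X hX => ?_) ▸ hz k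
  have hX1 := ((mem_thetaBody_iff hS).mp (hFT hX)).2
  have h1 := trace_mul_re_nonneg (hFT hX).1 hWV
  rw [mul_sub, trace_sub, Complex.sub_re, hF1 X hX, Finset.mul_sum, trace_sum, Complex.re_sum] at h1
  have h2 : ∀ i, ((X : Matrix ι ι ℂ) * w i • z i).trace.re =
      w i * ((X : Matrix ι ι ℂ) * z i).trace.re := fun i => by
    rw [smul_real_eq_smul_complex, Matrix.mul_smul, trace_smul, smul_eq_mul, Complex.re_ofReal_mul]
  simp only [h2] at h1
  have h3 : w k * (1 - ((X : Matrix ι ι ℂ) * z k).trace.re) ≤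
      ∑ i, w i * (1 - ((X : Matrix ι ι ℂ) * z i).trace.re) :=
    Finset.single_le_sum (f := fun i => w i * (1 - ((X : Matrix ι ι ℂ) * z i).trace.re))
      (fun i _ => mul_nonneg (hw i) (sub_nonneg.mpr (hX1 _ (hz i)))) (Finset.mem_univ k)
  simp only [mul_sub, mul_one, Finset.sum_sub_distrib, hw1] at h3
  have h4 : w k * 1 ≤ w k * ((X : Matrix ι ι ℂ) * z k).trace.re := by linarith
  exact le_of_mul_le_mul_left h4 hk

theorem vectorize_smul_add_smul (a b : ℂ) (M N : Matrix ι ι ℂ) :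
    vectorize (a • M + b • N) = a • vectorize M + b • vectorize N := by
  ext ⟨i, j⟩
  simp [vectorize_apply]

/-- The rotation of a feasible vector towards a vector in the slack stays feasible. -/
theorem IsUnitFeasible.rotate {M N : Matrix ι ι ℂ} {Y : Matrix (ι × ι) (ι × ι) ℂ}
    (h : IsUnitFeasible S M Y)
    (hN : (Y - ketBra (vectorize M) - ketBra (vectorize N)).PosSemidef) {a b : ℂ}
    (hab : star a * a + star b * b = 1) : IsUnitFeasible S (a • M + b • N) Y where
  mem := h.mem
  partialTrace_le := h.partialTrace_le
  ketBra_le := by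
    have := hN.add (posSemidef_ketBra_add_sub (vectorize M) (vectorize N) hab)
    rw [← vectorize_smul_add_smul] at this
    convert this using 1
    simp only [ketBra]
    abel

/-- First-order optimality along the rotations towards the slack. -/
theorem trace_mul_re_eq_zero_of_slack {X M N : Matrix ι ι ℂ} (hX : X.IsHermitian)
    {Y : Matrix (ι × ι) (ι × ι) ℂ} (h : IsUnitFeasible S M Y)
    (hN : (Y - ketBra (vectorize M) - ketBra (vectorize N)).PosSemidef)
    (hX1 : ∀ W ∈ unitWeights S, (X * W).trace.re ≤ 1) (hXM : (X * (M * Mᴴ)).trace.re = 1) :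
    (X * (N * Mᴴ)).trace.re = 0 := by
  refine eq_zero_of_forall_quadratic_nonpos (k := (X * (N * Nᴴ)).trace.re - 1) fun t => ?_
  -- The rotation is M ↦ (M + tN)/√(1 + t²); clearing the denominator in Tr ≤ 1 leaves the quadratic
  -- in t.
  set c : ℝ := (√(1 + t ^ 2))⁻¹ with hc
  have hpos : 0 < 1 + t ^ 2 := by positivity
  have hc0 : 0 < c := by positivity
  have hc2 : c ^ 2 * (1 + t ^ 2) = 1 := by
    rw [hc, inv_pow, Real.sq_sqrt hpos.le, inv_mul_cancel₀ hpos.ne']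
  have hab : star (c : ℂ) * c + star ((t * c : ℝ) : ℂ) * ((t * c : ℝ) : ℂ) = 1 := by
    rw [show star (c : ℂ) = c from Complex.conj_ofReal _,
      show star ((t * c : ℝ) : ℂ) = ((t * c : ℝ) : ℂ) from Complex.conj_ofReal _]
    have : ((c ^ 2 * (1 + t ^ 2) : ℝ) : ℂ) = 1 := by rw [hc2]; simp
    push_cast at this ⊢
    linear_combination this
  have h1 := hX1 _ ⟨_, Y, h.rotate hN hab, rfl⟩
  have h2 : (X * (M * Nᴴ)).trace.re = (X * (N * Mᴴ)).trace.re := by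
    have h3 : (X * (M * Nᴴ))ᴴ = N * Mᴴ * X := by
      rw [conjTranspose_mul, conjTranspose_mul, conjTranspose_conjTranspose, hX.eq]
    have h4 := congrArg (fun A => (trace A).re) h3
    simp only [trace_conjTranspose] at h4
    rw [trace_mul_comm (N * Mᴴ)] at h4
    rw [← h4]
    exact (Complex.conj_re _).symm
  have h5 : (X * (((c : ℂ) • M + ((t * c : ℝ) : ℂ) • N) *
      ((c : ℂ) • M + ((t * c : ℝ) : ℂ) • N)ᴴ)).trace.re =
      c ^ 2 * (1 + 2 * t * (X * (N * Mᴴ)).trace.re + t ^ 2 * (X * (N * Nᴴ)).trace.re) := by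
    rw [conjTranspose_add, conjTranspose_smul, conjTranspose_smul,
      show star (c : ℂ) = c from Complex.conj_ofReal _,
      show star ((t * c : ℝ) : ℂ) = ((t * c : ℝ) : ℂ) from Complex.conj_ofReal _]
    simp only [add_mul, mul_add, Matrix.smul_mul, Matrix.mul_smul, trace_add, trace_smul,
      smul_eq_mul, Complex.add_re, Complex.re_ofReal_mul, hXM, h2]
    ring
  rw [h5] at h1
  have h6 : c ^ 2 * (t ^ 2 * ((X * (N * Nᴴ)).trace.re - 1) + 2 * t * (X * (N * Mᴴ)).trace.re) ≤ 0 := by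
    nlinarith
  by_contra! h7
  nlinarith [mul_pos (pow_pos hc0 2) h7]

/-- iN has the same ketbra as N, so the real condition also applies to it and kills the imaginary
part. -/
theorem trace_mul_eq_zero_of_slack {X M N : Matrix ι ι ℂ} (hX : X.IsHermitian)
    {Y : Matrix (ι × ι) (ι × ι) ℂ} (h : IsUnitFeasible S M Y)
    (hN : (Y - ketBra (vectorize M) - ketBra (vectorize N)).PosSemidef)
    (hX1 : ∀ W ∈ unitWeights S, (X * W).trace.re ≤ 1) (hXM : (X * (M * Mᴴ)).trace.re = 1) :
    (X * (N * Mᴴ)).trace = 0 := by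
  have h1 := trace_mul_re_eq_zero_of_slack hX h hN hX1 hXM
  have hIN : ketBra (vectorize (Complex.I • N)) = ketBra (vectorize N) := by
    ext ⟨i, j⟩ ⟨i', j'⟩
    simp only [ketBra_vectorize_apply, Matrix.smul_apply, smul_eq_mul, star_mul]
    rw [show star Complex.I = -Complex.I from Complex.conj_I]
    linear_combination (-(N i j * star (N i' j'))) * Complex.I_mul_I
  have h2 := trace_mul_re_eq_zero_of_slack hX h (N := Complex.I • N) (by rwa [hIN]) hX1 hXM
  rw [Matrix.smul_mul, Matrix.mul_smul, trace_smul, smul_eq_mul, Complex.I_mul_re] at h2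
  exact Complex.ext h1 (by simpa using h2)

/-- The slack of the weight of a facet vanishes on its support. -/
theorem mul_mul_mem_of_facet_normal [Nonempty ι] (hS : IsNoncommGraph S)
    (hFT : F ⊆ thetaBody S) (hspan : Submodule.span ℝ F = ⊤) (hV : V.IsHermitian)
    (hF1 : ∀ X ∈ F, ((X : Matrix ι ι ℂ) * V).trace.re = 1) (hVW : V ∈ unitWeights S)
    (A : Matrix ι ι ℂ) : V * A * V ∈ S := by
  obtain ⟨M, Y, h, rfl⟩ := hVW
  set R := Y - ketBra (vectorize M) with hR
  obtain ⟨hs, hs2⟩ := sqrt_spec h.ketBra_le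
  set Q := CFC.sqrt R with hQ
  -- Each column of Q = √R, read as an operator N, has |N⟩⟨N| ≤ R, so the slack condition applies to
  -- it.
  have hcol : ∀ k, (of fun i j => Q (i, j) k) * Mᴴ = 0 := fun k => by
    refine eq_zero_of_span_eq_top hspan fun X hX => ?_
    refine trace_mul_eq_zero_of_slack X.2 h ?_ ((mem_thetaBody_iff hS).mp (hFT hX)).2 (hF1 X hX)
    have h1 : ketBra (vectorize (of fun i j => Q (i, j) k)) = Q * single k k 1 * Qᴴ := by
      ext ⟨i, j⟩ ⟨i', j'⟩
      rw [ketBra_vectorize_apply]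
      simp [mul_apply, single_apply, ite_and]
    have h2 : Q * (1 - single k k 1) * Qᴴ = R - Q * single k k 1 * Qᴴ := by
      rw [mul_sub, sub_mul, mul_one, hs.isHermitian.eq, hs2]
    rw [h1, ← hR, ← h2]
    refine PosSemidef.mul_mul_conjTranspose_same ?_ Q
    have h3 : (1 : Matrix (ι × ι) (ι × ι) ℂ) - single k k 1 =
        diagonal fun p => if p = k then 0 else 1 := by
      rw [← diagonal_one, ← diagonal_single, diagonal_sub]
      congr 1
      ext p
      by_cases hp : p = k <;> simp [hp]
    rw [h3]
    refine PosSemidef.diagonal fun p => ?_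
    by_cases hp : p = k <;> simp [hp]
  have hDQ : ((1 : Matrix ι ι ℂ) ⊗ₖ (Mᴴ)ᵀ) * Q = 0 := by
    ext ⟨i, j⟩ k
    have h1 := congrFun (congrFun (hcol k) i) j
    simp only [mul_apply, of_apply, Matrix.zero_apply] at h1
    rw [mul_apply, Fintype.sum_prod_type]
    simpa [one_apply, mul_comm] using h1
  have hDR : ((1 : Matrix ι ι ℂ) ⊗ₖ (Mᴴ)ᵀ) * R * ((1 : Matrix ι ι ℂ) ⊗ₖ (Mᴴ)ᵀ)ᴴ = 0 := by
    rw [hR, ← hs2, ← mul_assoc, hDQ]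
    simp
  -- With the slack gone, the conjugate of Y is |M M†⟩⟨M M†| = |V⟩⟨V|.
  have hmem := one_kronecker_conj_mem_tensorFull (Mᴴ)ᵀ h.mem
  rw [hR, mul_sub, sub_mul, one_kronecker_conj_ketBra_vectorize, sub_eq_zero,
    transpose_transpose] at hDR
  rw [hDR] at hmem
  have := mul_mul_mem_of_ketBra_mem_tensorFull hmem A
  rwa [hV.eq] at this

/-- A matrix that cuts out a spanning part of the theta body is a maximal full projector. -/
theorem isMaximalFullProjector_of_facet_normal [Nonempty ι] (hS : IsNoncommGraph S)
    (hFT : F ⊆ thetaBody S) (hspan : Submodule.span ℝ F = ⊤) (hV : V.IsHermitian)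
    (hF1 : ∀ X ∈ F, ((X : Matrix ι ι ℂ) * V).trace.re = 1)
    (hle : ∀ X ∈ thetaBody S, ((X : Matrix ι ι ℂ) * V).trace.re ≤ 1) :
    IsMaximalFullProjector S V := by
  have hVW := facet_normal_mem_unitWeights hS hFT hspan hV hF1 hle
  obtain ⟨P, K, hP, hPV, hPK, hPK'⟩ := exists_support_projection
    (posSemidef_of_mem_unitWeights hVW) (le_one_of_mem_unitWeights hVW)
  have hfull : IsFullProjector S P := ⟨hP, fun A => by
    have := mul_mul_mem_of_facet_normal hS hFT hspan hV hF1 hVW (K * A * K)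
    nth_rewrite 1 [hPK]
    rw [hPK']
    simpa only [mul_assoc] using this⟩
  have hPV' : P = V :=
    eq_of_mem_unitWeights_of_le hS hFT hspan hV hF1 hfull.mem_unitWeights hPV
  refine ⟨hPV' ▸ hfull, fun Q hQ hQV => ?_⟩
  exact eq_of_mem_unitWeights_of_le hS hFT hspan hV hF1 hQ.mem_unitWeights hQV

end Facet

/-! ### Hyperplanes through the origin -/

theorem zero_mem_thetaBody (S : Submodule ℂ (Matrix ι ι ℂ)) : (0 : Herm ι) ∈ thetaBody S :=
  ⟨by simpa using PosSemidef.zero, fun W _ _ => by simp⟩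

/-- The theta body contains a multiple of every positive semidefinite matrix. -/
theorem exists_smul_mem_thetaBody [Nonempty ι] {S : Submodule ℂ (Matrix ι ι ℂ)}
    (hS : IsNoncommGraph S) {X : Matrix ι ι ℂ} (hX : X.PosSemidef) :
    ∃ r : ℝ, 0 < r ∧ ∃ Z ∈ thetaBody S, (Z : Matrix ι ι ℂ) = (r : ℂ) • X := by
  have ht : 0 ≤ X.trace.re := (Complex.nonneg_iff.mp hX.trace_nonneg).1
  set r : ℝ := (X.trace.re + 1)⁻¹ with hr
  have hr0 : 0 < r := by positivity
  have hXr := smul_posSemidef hX hr0.le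
  refine ⟨r, hr0, ⟨(r : ℂ) • X, hXr.isHermitian⟩, (mem_thetaBody_iff hS).mpr ⟨hXr, fun W hW => ?_⟩,
    rfl⟩
  have h1 := trace_mul_re_nonneg hX (le_one_of_mem_unitWeights hW)
  rw [mul_sub, mul_one, trace_sub, Complex.sub_re] at h1
  rw [Matrix.smul_mul, trace_smul, smul_eq_mul, Complex.re_ofReal_mul, hr,
    inv_mul_le_iff₀ (by positivity)]
  linarith

theorem traceForm_ne_zero {Y : Herm ι} (hY : Y ≠ 0) : traceForm (Y : Matrix ι ι ℂ) ≠ 0 := by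
  intro h
  have h1 : ((Y : Matrix ι ι ℂ) * Y).trace.re = 0 := LinearMap.congr_fun h Y
  have hYs : (Y : Matrix ι ι ℂ).IsHermitian := Y.2
  have h2 : ((Y : Matrix ι ι ℂ)ᴴ * Y).trace = 0 := by
    rw [hYs.eq]
    exact Complex.ext h1 (trace_mul_im_of_isHermitian hYs hYs)
  exact hY (Subtype.ext (trace_conjTranspose_mul_self_eq_zero_iff.mp h2))

/-- For n = 0 the dimension condition would read d + 1 = 0. -/
theorem IsFacet.nonempty_index {C F : Set (Herm ι)} (h : IsFacet C F) : Nonempty ι := by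
  by_contra hι
  rw [not_nonempty_iff] at hι
  have h1 := h.finrank_direction
  rw [Module.finrank_matrix] at h1
  simp at h1

theorem IsFacet.finrank_direction_add_one {C F : Set (Herm ι)} (h : IsFacet C F) :
    Module.finrank ℝ (affineSpan ℝ F).direction + 1 = Module.finrank ℝ (Herm ι) :=
  h.finrank_direction.trans finrank_herm.symm

/-- In dimension at least two, no facet of a set of positive semidefinite matrices is cut out by a
hyperplane through the origin on which the inner products are nonnegative. -/
theorem not_isFacet_of_trace_mul_eq_zero (hι : 1 < Fintype.card ι) {C F : Set (Herm ι)}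
    (h : IsFacet C F) (hF : ∀ X ∈ F, (X : Matrix ι ι ℂ).PosSemidef) {Q : Herm ι} (hQ : Q ≠ 0)
    (hQpos : (Q : Matrix ι ι ℂ).PosSemidef)
    (hFQ : ∀ X ∈ F, ((X : Matrix ι ι ℂ) * (Q : Matrix ι ι ℂ)).trace.re = 0) : False := by
  have hker := direction_eq_ker h.finrank_direction_add_one (traceForm_ne_zero hQ) hFQ
  have hherm : ∀ X : Herm ι, ((X : Matrix ι ι ℂ) * (Q : Matrix ι ι ℂ)).trace.re = 0 →
      (X : Matrix ι ι ℂ) * (Q : Matrix ι ι ℂ) = 0 := fun X hX => by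
    have hXs : X ∈ Submodule.span ℝ F := mem_span_of_mem_direction (hker ▸ hX)
    clear hX
    induction hXs using Submodule.span_induction with
    | mem X hX => exact mul_eq_zero_of_trace_mul_re_eq_zero (hF X hX) hQpos (hFQ X hX)
    | zero => simp
    | add X Y _ _ hX hY => rw [AddSubgroup.coe_add, add_mul, hX, hY, add_zero]
    | smul r X _ hX =>
      rw [selfAdjoint.val_smul, smul_real_eq_smul_complex, Matrix.smul_mul, hX, smul_zero]
  -- Traces of products of Hermitian matrices are real, so the condition splits over real and
  -- imaginary parts.
  have hall : ∀ X : Matrix ι ι ℂ, (X * (Q : Matrix ι ι ℂ)).trace = 0 →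
      X * (Q : Matrix ι ι ℂ) = 0 := fun X hX => by
    have hre := trace_mul_im_of_isHermitian (X := (realPart X : Matrix ι ι ℂ)) (realPart X).2 Q.2
    have him := trace_mul_im_of_isHermitian (X := (imaginaryPart X : Matrix ι ι ℂ))
      (imaginaryPart X).2 Q.2
    rw [← realPart_add_I_smul_imaginaryPart X] at hX ⊢
    rw [add_mul, Matrix.smul_mul, trace_add, trace_smul, smul_eq_mul] at hX
    rw [add_mul, Matrix.smul_mul]
    have h1 := congrArg Complex.re hX
    have h2 := congrArg Complex.im hX
    simp only [Complex.add_re, Complex.I_mul_re, Complex.zero_re, him, neg_zero, add_zero] at h1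
    simp only [Complex.add_im, Complex.I_mul_im, Complex.zero_im, hre, zero_add] at h2
    rw [hherm _ h1, hherm _ h2, smul_zero, add_zero]
  refine hQ (Subtype.ext ?_)
  ext k l
  obtain ⟨m, hm⟩ := Fintype.exists_ne_of_one_lt_card hι l
  set q : Matrix ι ι ℂ := (Q : Matrix ι ι ℂ) with hq
  -- This matrix is trace-orthogonal to q, and since m ≠ l its product with q has (m, l) entry q k l
  -- squared. The choice of m needs n > 1.
  have h0 := hall (q k l • single m k 1 - q k m • single l k 1) (by
    simp only [sub_mul, Matrix.smul_mul, trace_sub, trace_smul, trace_single_mul, smul_eq_mul]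
    ring)
  have h1 := congrFun (congrFun h0 m) l
  simp only [sub_mul, Matrix.smul_mul, Matrix.sub_apply, Matrix.smul_apply,
    single_mul_apply_same, single_mul_apply_of_ne _ _ _ _ _ hm, smul_eq_mul, Matrix.zero_apply] at h1
  simpa using h1

/-! ### The two halves of the theorem -/

theorem isMaximalFullProjector_of_isFacet {S : Submodule ℂ (Matrix ι ι ℂ)}
    (hS : IsNoncommGraph S) {V : Matrix ι ι ℂ}
    (h : IsFacet (thetaBody S) {X | X ∈ thetaBody S ∧ ((X : Matrix ι ι ℂ) * V).trace = 1}) :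
    IsMaximalFullProjector S V := by
  have := h.nonempty_index
  set F : Set (Herm ι) := {X | X ∈ thetaBody S ∧ ((X : Matrix ι ι ℂ) * V).trace = 1} with hF
  have hF1 : ∀ X ∈ F, traceForm V X = 1 := fun X hX => by
    rw [traceForm_apply, hX.2, Complex.one_re]
  have hdim := h.finrank_direction_add_one
  have hspan := span_eq_top_of_hyperplane h.nonempty hdim hF1
  -- V and V† both have trace 1 against every X ∈ F, and F spans.
  have hV : V.IsHermitian := by
    refine sub_eq_zero.mp (eq_zero_of_span_eq_top hspan fun X hX => ?_)
    have hXs : (X : Matrix ι ι ℂ)ᴴ = X := X.2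
    rw [mul_sub, trace_sub, hX.2, trace_mul_comm, ← hXs, ← conjTranspose_mul, trace_conjTranspose,
      hX.2]
    simp
  obtain ⟨X0, hX0⟩ := h.nonempty
  obtain ⟨Y, a, hY, hle, hFY⟩ := h.exists_hyperplane
  have hFY' : ∀ X ∈ F, traceForm (Y : Matrix ι ι ℂ) X = a := fun X hX => by
    rw [hFY] at hX
    exact hX.2
  have hV0 : traceForm V ≠ 0 := fun h0 => by
    have := hF1 X0 hX0
    rw [h0] at this
    simp at this
  have hkerV := direction_eq_ker hdim hV0 hF1
  have hkerY := direction_eq_ker hdim (traceForm_ne_zero hY) hFY'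
  -- Both functionals have the direction of F as kernel, hence are proportional. The supporting
  -- inequality for Y then passes to V once a > 0.
  have hprop : ∀ X, traceForm (Y : Matrix ι ι ℂ) X = traceForm V X * a := fun X => by
    have h1 : X - traceForm V X • X0 ∈ LinearMap.ker (traceForm (Y : Matrix ι ι ℂ)) := by
      rw [← hkerY, hkerV]
      simp [hF1 X0 hX0]
    rw [LinearMap.mem_ker, map_sub, map_smul, hFY' X0 hX0, smul_eq_mul, sub_eq_zero] at h1
    exact h1
  have ha0 : 0 ≤ a := by simpa using hle 0 (zero_mem_thetaBody S)
  have ha : 0 < a := ha0.lt_of_ne fun h0 => traceForm_ne_zero hY (LinearMap.ext fun X => by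
    rw [hprop, ← h0, mul_zero, LinearMap.zero_apply])
  refine isMaximalFullProjector_of_facet_normal hS (fun X hX => hX.1) hspan hV hF1 fun X hX => ?_
  have h1 : traceForm (Y : Matrix ι ι ℂ) X ≤ a := hle X hX
  rw [hprop] at h1
  exact (mul_le_iff_le_one_left ha).mp h1

theorem exists_isMaximalFullProjector_of_isFacet {S : Submodule ℂ (Matrix ι ι ℂ)}
    (hS : IsNoncommGraph S) (hι : 1 < Fintype.card ι) {F : Set (Herm ι)}
    (h : IsFacet (thetaBody S) F) :
    ∃ V : Matrix ι ι ℂ, IsMaximalFullProjector S V ∧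
      F = {X | X ∈ thetaBody S ∧ ((X : Matrix ι ι ℂ) * V).trace = 1} := by
  have := h.nonempty_index
  obtain ⟨Y, a, hY, hle, hFY⟩ := h.exists_hyperplane
  have hYs : (Y : Matrix ι ι ℂ).IsHermitian := Y.2
  have hFT : F ⊆ thetaBody S := fun X hX => by rw [hFY] at hX; exact hX.1
  have ha0 : 0 ≤ a := by simpa using hle 0 (zero_mem_thetaBody S)
  obtain rfl | ha := ha0.eq_or_lt
  · exfalso
    refine not_isFacet_of_trace_mul_eq_zero hι h (fun X hX => (hFT hX).1) (neg_ne_zero.mpr hY) ?_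
      fun X hX => ?_
    -- TH(S) contains a positive multiple of each P ≥ 0, so a bound by a = 0 forces -Y ≥ 0.
    · refine posSemidef_of_trace_mul_re_nonneg (-Y).2 fun P hP => ?_
      obtain ⟨r, hr, Z, hZ, hZP⟩ := exists_smul_mem_thetaBody hS hP
      have h1 := hle Z hZ
      rw [hZP, Matrix.smul_mul, trace_smul, smul_eq_mul, Complex.re_ofReal_mul] at h1
      rw [AddSubgroup.coe_neg, neg_mul, trace_neg, Complex.neg_re, trace_mul_comm]
      by_contra! h2
      nlinarith [mul_pos hr (neg_pos.mpr h2)]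
    · rw [hFY] at hX
      rw [AddSubgroup.coe_neg, mul_neg, trace_neg, Complex.neg_re, hX.2, neg_zero]
  · set V : Matrix ι ι ℂ := ((a⁻¹ : ℝ) : ℂ) • (Y : Matrix ι ι ℂ) with hVdef
    have hV : V.IsHermitian := by
      rw [IsHermitian, hVdef, conjTranspose_smul, hYs.eq,
        show star ((a⁻¹ : ℝ) : ℂ) = ((a⁻¹ : ℝ) : ℂ) from Complex.conj_ofReal _]
    have hval : ∀ X : Herm ι, ((X : Matrix ι ι ℂ) * V).trace.re =
        ((X : Matrix ι ι ℂ) * (Y : Matrix ι ι ℂ)).trace.re / a := fun X => by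
      rw [hVdef, Matrix.mul_smul, trace_smul, smul_eq_mul, Complex.re_ofReal_mul, div_eq_inv_mul]
    have hF1 : ∀ X ∈ F, ((X : Matrix ι ι ℂ) * V).trace.re = 1 := fun X hX => by
      rw [hFY] at hX
      rw [hval, hX.2, div_self ha.ne']
    have hspan := span_eq_top_of_hyperplane (f := traceForm V) h.nonempty
      h.finrank_direction_add_one hF1
    refine ⟨V, isMaximalFullProjector_of_facet_normal hS hFT hspan hV hF1 fun X hX => ?_, ?_⟩
    · rw [hval, div_le_one ha]
      exact hle X hX
    · rw [hFY]
      ext X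
      refine and_congr_right fun _ => ⟨fun hX => ?_, fun hX => ?_⟩
      · refine Complex.ext ?_ (trace_mul_im_of_isHermitian X.2 hV)
        rw [hval, hX, div_self ha.ne', Complex.one_re]
      · have h1 := hval X
        rw [hX, Complex.one_re, eq_div_iff ha.ne', one_mul] at h1
        exact h1.symm

end ThetaFacet

end

theorem mainTheorem7 {ι : Type*} [Fintype ι] [DecidableEq ι]
    (S : Submodule ℂ (Matrix ι ι ℂ)) (hS : ThetaFacet.IsNoncommGraph S) :
    (∀ V : Matrix ι ι ℂ,
      ThetaFacet.IsFacet (ThetaFacet.thetaBody S)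
        {X | X ∈ ThetaFacet.thetaBody S ∧ ((X : Matrix ι ι ℂ) * V).trace = 1} →
      ThetaFacet.IsMaximalFullProjector S V) ∧
    (1 < Fintype.card ι →
      ∀ F : Set (ThetaFacet.Herm ι), ThetaFacet.IsFacet (ThetaFacet.thetaBody S) F →
        ∃ V : Matrix ι ι ℂ, ThetaFacet.IsMaximalFullProjector S V ∧
          F = {X | X ∈ ThetaFacet.thetaBody S ∧ ((X : Matrix ι ι ℂ) * V).trace = 1}) :=
  ⟨fun _ h => ThetaFacet.isMaximalFullProjector_of_isFacet hS h,
    fun hι _ h => ThetaFacet.exists_isMaximalFullProjector_of_isFacet hS hι h⟩
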